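/- Let $\ell^2=\ell^2(\mathbb{Z}_+)$ be the Hilbert space of square-summable complex sequences with its standard orthonormal basis $(e_n)_{n\ge 0}$, let $T$ be the unilateral right shift, $Te_n=e_{n+1}$, and let the Toeplitz algebra $\mathcal{T}\subseteq\mathcal{B}(\ell^2)$ be the norm-closed $*$-algebra of operators generated by $T$. Put $T_{n,m}=T^nT^{*m}$ for $n,m\in\mathbb{Z}_+$. All tensor products $\otimes$ of $C^*$-algebras are minimal. A compact quantum semigroup is a pair $(\mathcal{A},\Delta)$ of a unital $C^*$-algebra $\mathcal{A}$ and a unital $*$-homomorphism $\Delta\colon\mathcal{A}\to\mathcal{A}\otimes\mathcal{A}$ that is coassociative: $(\Delta\otimes\mathrm{id})\Delta=(\mathrm{id}\otimes\Delta)\Delta$ (with $(\mathcal{A}\otimes\mathcal{A})\otimes\mathcal{A}$ and $\mathcal{A}\otimes(\mathcal{A}\otimes\mathcal{A})$ identified canonically). **Theorem.** There is exactly one unital $*$-homomorphism $\Delta\colon\mathcal{T}\to\mathcal{T}\otimes\mathcal{T}$ with $\Delta(T)=T\otimes T$. It satisfies $\Delta(T_{n,m})=T_{n,m}\otimes T_{n,m}$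 for all $n,m\in\mathbb{Z}_+$, and $(\mathcal{T},\Delta)$ is a compact quantum semigroup. Moreover $(\mathcal{T},\Delta)$ is cocommutative, that is, $\sigma(\Delta(a))=\Delta(a)$ for all $a\in\mathcal{T}$, where $\sigma$ is the flip automorphism of $\mathcal{T}\otimes\mathcal{T}$ with $\sigma(a\otimes b)=b\otimes a$; and $\Delta$ is isometric, that is, $\|\Delta(a)\|=\|a\|$ for all $a\in\mathcal{T}$. -/

import Mathlib

open scoped TensorProduct InnerProductSpace

noncomputable section

namespace QSemigroup

universe u v w

/-! ## Hilbert space tensor products and tensor products of operators -/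

/-- The Hilbert space tensor product: the completion of the algebraic tensor product with
respect to the inner product `⟪x ⊗ y, x' ⊗ y'⟫ = ⟪x, x'⟫ * ⟪y, y'⟫`. -/
def HilbertTensor (H : Type u) (K : Type v)
    [NormedAddCommGroup H] [InnerProductSpace ℂ H]
    [NormedAddCommGroup K] [InnerProductSpace ℂ K] : Type (max u v) :=
  UniformSpace.Completion (H ⊗[ℂ] K)

section Operators

variable {H : Type u} {K : Type v}
  [NormedAddCommGroup H] [InnerProductSpace ℂ H]
  [NormedAddCommGroup K] [InnerProductSpace ℂ K]

instance HilbertTensor.instNormedAddCommGroup : NormedAddCommGroup (HilbertTensor H K) :=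
  inferInstanceAs (NormedAddCommGroup (UniformSpace.Completion (H ⊗[ℂ] K)))

instance HilbertTensor.instInnerProductSpace : InnerProductSpace ℂ (HilbertTensor H K) :=
  inferInstanceAs (InnerProductSpace ℂ (UniformSpace.Completion (H ⊗[ℂ] K)))

instance HilbertTensor.instCompleteSpace : CompleteSpace (HilbertTensor H K) :=
  inferInstanceAs (CompleteSpace (UniformSpace.Completion (H ⊗[ℂ] K)))

/-- The isometric embedding of the algebraic tensor product in its completion. -/
def HilbertTensor.embed : H ⊗[ℂ] K →ₗᵢ[ℂ] HilbertTensor H K :=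
  UniformSpace.Completion.toComplₗᵢ

theorem HilbertTensor.denseRange_embed :
    DenseRange (HilbertTensor.embed : H ⊗[ℂ] K →ₗᵢ[ℂ] HilbertTensor H K) :=
  UniformSpace.Completion.denseRange_coe

/-- The elementary tensor `x ⊗ y` of two vectors, in the Hilbert space tensor product. -/
def vecTensor (x : H) (y : K) : HilbertTensor H K :=
  HilbertTensor.embed (x ⊗ₜ[ℂ] y)

theorem inner_vecTensor (x x' : H) (y y' : K) :
    ⟪vecTensor x y, vecTensor x' y'⟫_ℂ = ⟪x, x'⟫_ℂ * ⟪y, y'⟫_ℂ := by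
  simp [vecTensor]

/-- The tensor product `a ⊗ b` of two bounded operators: the bounded operator on the Hilbert
space tensor product with `(a ⊗ b) (x ⊗ y) = a x ⊗ b y`. -/
def opTensor (a : H →L[ℂ] H) (b : K →L[ℂ] K) :
    HilbertTensor H K →L[ℂ] HilbertTensor H K :=
  (TensorProduct.mapL a b).completion

theorem opTensor_vecTensor (a : H →L[ℂ] H) (b : K →L[ℂ] K) (x : H) (y : K) :
    opTensor a b (vecTensor x y) = vecTensor (a x) (b y) := by
  refine (ContinuousLinearMap.completion_apply_coe (TensorProduct.mapL a b) (x ⊗ₜ[ℂ] y)).trans ?_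
  simp only [TensorProduct.mapL_tmul]
  rfl

end Operators

/-! ## The minimal tensor product of concrete C*-algebras -/

section MinTensor

variable {H : Type u} {K : Type v}
  [NormedAddCommGroup H] [InnerProductSpace ℂ H] [CompleteSpace H]
  [NormedAddCommGroup K] [InnerProductSpace ℂ K] [CompleteSpace K]

/-- The minimal (spatial) C*-tensor product of two unital *-algebras of operators `A ⊆ B(H)` and
`B ⊆ B(K)`: the norm closed *-algebra of operators on the Hilbert space tensor product of `H`
and `K` generated by the operators `a ⊗ b` with `a ∈ A` and `b ∈ B`. -/
def minTensor (A : StarSubalgebra ℂ (H →L[ℂ] H)) (B : StarSubalgebra ℂ (K →L[ℂ] K)) :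
    StarSubalgebra ℂ (HilbertTensor H K →L[ℂ] HilbertTensor H K) :=
  (StarAlgebra.adjoin ℂ {c | ∃ a ∈ A, ∃ b ∈ B, c = opTensor a b}).topologicalClosure

/-- The elementary tensor `a ⊗ b` as an element of the minimal tensor product. -/
def elemTensor {A : StarSubalgebra ℂ (H →L[ℂ] H)} {B : StarSubalgebra ℂ (K →L[ℂ] K)}
    (a : A) (b : B) : minTensor A B :=
  ⟨opTensor (a : H →L[ℂ] H) (b : K →L[ℂ] K),
    StarSubalgebra.le_topologicalClosure _
      (StarAlgebra.subset_adjoin ℂ _ ⟨a, a.2, b, b.2, rfl⟩)⟩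

/-- Unital *-homomorphisms on a C*-algebra generated by a set are determined by their values on
that set. -/
theorem starAlgHom_ext_closure {𝔄 𝔅 : Type*} [CStarAlgebra 𝔄] [CStarAlgebra 𝔅]
    (s : Set 𝔄) {Φ Ψ : (StarAlgebra.adjoin ℂ s).topologicalClosure →⋆ₐ[ℂ] 𝔅}
    (h : ∀ y (hy : y ∈ s),
      Φ ⟨y, StarSubalgebra.le_topologicalClosure _ (StarAlgebra.subset_adjoin ℂ _ hy)⟩
        = Ψ ⟨y, StarSubalgebra.le_topologicalClosure _ (StarAlgebra.subset_adjoin ℂ _ hy)⟩) :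
    Φ = Ψ := by
  have hcl : IsClosed ((StarAlgebra.adjoin ℂ s).topologicalClosure : Set 𝔄) :=
    StarSubalgebra.isClosed_topologicalClosure _
  have cont : ∀ Θ : (StarAlgebra.adjoin ℂ s).topologicalClosure →⋆ₐ[ℂ] 𝔅, Continuous Θ :=
    fun Θ => AddMonoidHomClass.continuous_of_bound Θ 1
      (fun x => by simpa using NonUnitalStarAlgHom.norm_apply_le Θ x)
  refine StarAlgHomClass.ext_topologicalClosure (cont Φ) (cont Ψ) fun x => ?_
  refine StarAlgebra.adjoin_induction_subtype x ?_ ?_ ?_ ?_ ?_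
  · exact fun y hy => h y hy
  · intro r
    exact (AlgHomClass.commutes Φ r).trans (AlgHomClass.commutes Ψ r).symm
  · intro x y hx hy
    exact (map_add Φ _ _).trans ((congrArg₂ (· + ·) hx hy).trans (map_add Ψ _ _).symm)
  · intro x y hx hy
    exact (map_mul Φ _ _).trans ((congrArg₂ (· * ·) hx hy).trans (map_mul Ψ _ _).symm)
  · intro x hx
    exact (map_star Φ _).trans ((congrArg star hx).trans (map_star Ψ _).symm)

/-- A unital *-homomorphism from a minimal tensor product to a C*-algebra of operators is
determined by its values on elementary tensors. -/
theorem minTensor_hom_ext {L : Type w}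
    [NormedAddCommGroup L] [InnerProductSpace ℂ L] [CompleteSpace L]
    {A : StarSubalgebra ℂ (H →L[ℂ] H)} {B : StarSubalgebra ℂ (K →L[ℂ] K)}
    {C : StarSubalgebra ℂ (L →L[ℂ] L)}
    {Φ Ψ : minTensor A B →⋆ₐ[ℂ] C}
    (h : ∀ (a : A) (b : B), Φ (elemTensor a b) = Ψ (elemTensor a b)) : Φ = Ψ := by
  have key : C.subtype.comp Φ = C.subtype.comp Ψ := by
    refine starAlgHom_ext_closure _ ?_
    rintro y ⟨a, ha, b, hb, rfl⟩
    exact congrArg C.subtype (h ⟨a, ha⟩ ⟨b, hb⟩)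
  refine StarAlgHom.ext fun x => Subtype.ext ?_
  exact congrArg (fun f : minTensor A B →⋆ₐ[ℂ] (L →L[ℂ] L) => f x) key

end MinTensor

/-! ## Tensor products of *-homomorphisms, the flip, the associativity isomorphism -/

section Maps

variable {H : Type u} [NormedAddCommGroup H] [InnerProductSpace ℂ H] [CompleteSpace H]

/-- `Φ` is the *-homomorphism `φ ⊗ ψ` between the minimal tensor products, that is,
`Φ (a ⊗ b) = φ a ⊗ ψ b` for all `a` and `b`; at most one `Φ` has this property. -/
def IsTensorHom {H₁ H₂ K₁ K₂ : Type*}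
    [NormedAddCommGroup H₁] [InnerProductSpace ℂ H₁] [CompleteSpace H₁]
    [NormedAddCommGroup H₂] [InnerProductSpace ℂ H₂] [CompleteSpace H₂]
    [NormedAddCommGroup K₁] [InnerProductSpace ℂ K₁] [CompleteSpace K₁]
    [NormedAddCommGroup K₂] [InnerProductSpace ℂ K₂] [CompleteSpace K₂]
    {A₁ : StarSubalgebra ℂ (H₁ →L[ℂ] H₁)} {A₂ : StarSubalgebra ℂ (H₂ →L[ℂ] H₂)}
    {B₁ : StarSubalgebra ℂ (K₁ →L[ℂ] K₁)} {B₂ : StarSubalgebra ℂ (K₂ →L[ℂ] K₂)}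
    (φ : A₁ →⋆ₐ[ℂ] B₁) (ψ : A₂ →⋆ₐ[ℂ] B₂)
    (Φ : minTensor A₁ A₂ →⋆ₐ[ℂ] minTensor B₁ B₂) : Prop :=
  ∀ (a : A₁) (b : A₂), Φ (elemTensor a b) = elemTensor (φ a) (ψ b)

/-- `α` is the canonical isomorphism `(A ⊗ A) ⊗ A ≅ A ⊗ (A ⊗ A)`, that is,
`α ((a ⊗ b) ⊗ c) = a ⊗ (b ⊗ c)`. -/
def IsAssociator {A : StarSubalgebra ℂ (H →L[ℂ] H)}
    (α : minTensor (minTensor A A) A ≃⋆ₐ[ℂ] minTensor A (minTensor A A)) : Prop :=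
  ∀ a b c : A, α (elemTensor (elemTensor a b) c) = elemTensor a (elemTensor b c)

/-- `σ` is the flip automorphism of `A ⊗ A`, that is, `σ (a ⊗ b) = b ⊗ a`. -/
def IsFlip {A : StarSubalgebra ℂ (H →L[ℂ] H)}
    (σ : minTensor A A ≃⋆ₐ[ℂ] minTensor A A) : Prop :=
  ∀ a b : A, σ (elemTensor a b) = elemTensor b a

/-- Coassociativity `(Δ ⊗ id) Δ = (id ⊗ Δ) Δ`, where `(A ⊗ A) ⊗ A` and `A ⊗ (A ⊗ A)` are
identified by the canonical isomorphism. The existence of the three (unique) maps `Δ ⊗ id`,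
`id ⊗ Δ` and of the canonical isomorphism is part of the assertion. -/
def Coassociative {A : StarSubalgebra ℂ (H →L[ℂ] H)}
    (Δ : A →⋆ₐ[ℂ] minTensor A A) : Prop :=
  ∃ (Φ : minTensor A A →⋆ₐ[ℂ] minTensor (minTensor A A) A)
    (Ψ : minTensor A A →⋆ₐ[ℂ] minTensor A (minTensor A A))
    (α : minTensor (minTensor A A) A ≃⋆ₐ[ℂ] minTensor A (minTensor A A)),
    IsTensorHom Δ (StarAlgHom.id ℂ A) Φ ∧ IsTensorHom (StarAlgHom.id ℂ A) Δ Ψ ∧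
      IsAssociator α ∧ ∀ a : A, α (Φ (Δ a)) = Ψ (Δ a)

/-- Cocommutativity `σ (Δ a) = Δ a`, with `σ` the flip automorphism of `A ⊗ A`, whose existence
is part of the assertion (it is unique). -/
def Cocommutative {A : StarSubalgebra ℂ (H →L[ℂ] H)}
    (Δ : A →⋆ₐ[ℂ] minTensor A A) : Prop :=
  ∃ σ : minTensor A A ≃⋆ₐ[ℂ] minTensor A A, IsFlip σ ∧ ∀ a : A, σ (Δ a) = Δ a

/-- A compact quantum semigroup `(A, Δ)`: a unital C*-algebra `A` (here a norm closed unital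
*-subalgebra of some `B(H)`) with a coassociative unital *-homomorphism `Δ : A → A ⊗ A` to the
minimal tensor product. -/
structure IsCompactQuantumSemigroup (A : StarSubalgebra ℂ (H →L[ℂ] H))
    (Δ : A →⋆ₐ[ℂ] minTensor A A) : Prop where
  isClosed : IsClosed (A : Set (H →L[ℂ] H))
  coassociative : Coassociative Δ

end Maps

/-! ## The Toeplitz algebra -/

/-- The Hilbert space of square summable complex sequences `(f 0, f 1, f 2, …)`. -/
abbrev EllTwo : Type := lp (fun _ : ℕ => ℂ) 2

/-- The sequence `(0, f 0, f 1, …)`. -/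
def shiftFun (f : ℕ → ℂ) : ℕ → ℂ
  | 0 => 0
  | n + 1 => f n

theorem hasSum_shiftFun (f : EllTwo) :
    HasSum (fun n => ‖shiftFun f n‖ ^ 2) (‖f‖ ^ 2) := by
  rw [← hasSum_nat_add_iff' 1]
  have h := lp.hasSum_norm (p := 2) (by norm_num) f
  simpa [shiftFun] using h

theorem memℓp_shiftFun (f : EllTwo) : Memℓp (E := fun _ : ℕ => ℂ) (shiftFun f) 2 := by
  refine memℓp_gen ?_
  simpa using (hasSum_shiftFun f).summable

/-- The unilateral right shift `T` on `ℓ²`, `T (f 0, f 1, …) = (0, f 0, f 1, …)`. -/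
def shift : EllTwo →L[ℂ] EllTwo :=
  LinearMap.mkContinuous
    { toFun := fun f => ⟨shiftFun f, memℓp_shiftFun f⟩
      map_add' := fun f g => by
        ext n
        change shiftFun (⇑f + ⇑g) n = shiftFun f n + shiftFun g n
        cases n <;> simp [shiftFun]
      map_smul' := fun c f => by
        ext n
        cases n <;> simp [shiftFun] }
    1 (fun f => by
      have h := lp.hasSum_norm (p := 2) (by norm_num)
        (⟨shiftFun f, memℓp_shiftFun f⟩ : EllTwo)
      have h2 := h.unique (by simpa using hasSum_shiftFun f)
      have h3 : ‖(⟨shiftFun f, memℓp_shiftFun f⟩ : EllTwo)‖ ^ 2 = ‖f‖ ^ 2 := by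
        simpa using h2
      rw [one_mul]
      exact (pow_le_pow_iff_left₀ (norm_nonneg _) (norm_nonneg _) two_ne_zero).1 h3.le)

/-- `T e_n = e_{n+1}`. -/
theorem shift_single (n : ℕ) :
    shift (lp.single 2 n (1 : ℂ)) = lp.single 2 (n + 1) (1 : ℂ) := by
  ext k
  cases k with
  | zero => simp [shift, shiftFun]
  | succ k => simp [shift, shiftFun, Pi.single_apply]

/-- The Toeplitz algebra `𝒯`: the norm closed *-algebra of operators generated by `T`. -/
def toeplitz : StarSubalgebra ℂ (EllTwo →L[ℂ] EllTwo) :=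
  StarAlgebra.elemental ℂ shift

/-- The shift as an element of the Toeplitz algebra. -/
def toeplitzT : toeplitz := ⟨shift, StarAlgebra.elemental.self_mem ℂ shift⟩

/-- The element `T_{n,m} = T ^ n * (T*) ^ m` of the Toeplitz algebra. -/
def toeplitzMonomial (n m : ℕ) : toeplitz := toeplitzT ^ n * star toeplitzT ^ m

end QSemigroup

end

/-! The operator `T ⊗ T` moves `e_i ⊗ e_j` one step along the diagonal `i - j = d`, and each
diagonal carries a copy of the unilateral shift. Indexing diagonals by `d : ℤ` and positions by `min
i j` gives a unitary `U : ℓ²(ℕ) ⊗ ℓ²(ℤ) → ℓ²(ℕ) ⊗ ℓ²(ℕ)` (`exists_diagonal_unitary`) with `T ⊗ T = U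
(T ⊗ 1) U*`. Hence `Δ a = U (a ⊗ 1) U*` is the required homomorphism, with no appeal to the
universal property of the Toeplitz algebra. It is injective, hence isometric.

A *-homomorphism on the Toeplitz algebra is determined by its value at `T` (`toeplitz_hom_ext`).
This gives uniqueness, and reduces coassociativity and cocommutativity to the element `T`, where `Δ
T = T ⊗ T` makes them evident. What remains is the existence of `Δ ⊗ id`, `id ⊗ Δ`, the flip and the
associator: the first two come from ampliation followed by conjugation with a unitary, the last two
from conjugation alone (`exists_isTensorHom_id`, `exists_id_isTensorHom`, `exists_isFlip`,
`exists_isAssociator`). -/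

noncomputable section

namespace QSemigroup

universe u v

/-! ### Total families of vectors and the unitaries they determine. -/

section Total

variable {H : Type*} {K : Type*} {G : Type*}
  [NormedAddCommGroup H] [InnerProductSpace ℂ H]
  [NormedAddCommGroup K] [InnerProductSpace ℂ K]
  [NormedAddCommGroup G] [InnerProductSpace ℂ G]

/-- A family of vectors is total if its linear span is dense. -/
def IsTotal {ι : Type*} (v : ι → H) : Prop :=
  Dense (Submodule.span ℂ (Set.range v) : Set H)

theorem IsTotal.id : IsTotal (fun x : H => x) := by
  simp [IsTotal]

theorem IsTotal.le_topologicalClosure {ι : Type*} {v : ι → H} (hv : IsTotal v)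
    {S : Submodule ℂ H} (hS : IsClosed (S : Set H)) (h : ∀ i, v i ∈ S) (x : H) : x ∈ S := by
  have h1 : Submodule.span ℂ (Set.range v) ≤ S :=
    Submodule.span_le.2 (Set.range_subset_iff.2 h)
  have h2 : closure (Submodule.span ℂ (Set.range v) : Set H) ⊆ S := closure_minimal h1 hS
  exact h2 (hv x)

theorem IsTotal.clm_ext {ι : Type*} {v : ι → H} (hv : IsTotal v) {f g : H →L[ℂ] G}
    (h : ∀ i, f (v i) = g (v i)) : f = g :=
  ContinuousLinearMap.ext_on hv (by rintro _ ⟨i, rfl⟩; exact h i)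

theorem IsTotal.map {ι : Type*} {v : ι → H} (hv : IsTotal v) (e : H ≃ₗᵢ[ℂ] G) :
    IsTotal (fun i => e (v i)) := by
  have h := (e.surjective.denseRange).dense_image e.continuous hv
  refine h.mono ?_
  rintro _ ⟨x, hx, rfl⟩
  have h2 : (Submodule.span ℂ (Set.range v)).map (e.toLinearEquiv : H →ₗ[ℂ] G)
      ≤ Submodule.span ℂ (Set.range fun i => e (v i)) := by
    rw [Submodule.map_span, ← Set.range_comp]
    exact le_rfl
  exact h2 ⟨x, hx, rfl⟩

/-- The vector `x ⊗ y` as a continuous linear function of `y`. -/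
def vecTensorLeft (x : H) : K →L[ℂ] HilbertTensor H K :=
  (HilbertTensor.embed (H := H) (K := K)).toContinuousLinearMap ∘L TensorProduct.mkL ℂ H K x

/-- The vector `x ⊗ y` as a continuous linear function of `x`. -/
def vecTensorRight (y : K) : H →L[ℂ] HilbertTensor H K :=
  (HilbertTensor.embed (H := H) (K := K)).toContinuousLinearMap ∘L
    (TensorProduct.mkL ℂ H K).flip y

theorem isTotal_vecTensor_univ : IsTotal (fun p : H × K => vecTensor p.1 p.2) := by
  refine (HilbertTensor.denseRange_embed (H := H) (K := K)).mono ?_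
  rintro _ ⟨z, rfl⟩
  induction z using TensorProduct.induction_on with
  | zero => simp
  | tmul x y => exact Submodule.subset_span ⟨(x, y), rfl⟩
  | add a b ha hb =>
    rw [map_add]
    exact Submodule.add_mem _ ha hb

theorem IsTotal.vecTensor {ι κ : Type*} {v : ι → H} {w : κ → K} (hv : IsTotal v)
    (hw : IsTotal w) : IsTotal (fun p : ι × κ => vecTensor (v p.1) (w p.2)) := by
  set S := (Submodule.span ℂ
    (Set.range fun p : ι × κ => QSemigroup.vecTensor (v p.1) (w p.2))).topologicalClosure with hS
  have hc : IsClosed (S : Set (HilbertTensor H K)) := Submodule.isClosed_topologicalClosure _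
  have h1 : ∀ i y, QSemigroup.vecTensor (v i) y ∈ S := fun i y =>
    hw.le_topologicalClosure (S := S.comap (vecTensorLeft (v i)).toLinearMap)
      (hc.preimage (vecTensorLeft (v i)).continuous)
      (fun j => Submodule.le_topologicalClosure _ (Submodule.subset_span ⟨(i, j), rfl⟩)) y
  have h2 : ∀ x y, QSemigroup.vecTensor x y ∈ S := fun x y =>
    hv.le_topologicalClosure (S := S.comap (vecTensorRight y).toLinearMap)
      (hc.preimage (vecTensorRight y).continuous) (fun i => h1 i y) x
  rw [IsTotal, Submodule.dense_iff_topologicalClosure_eq_top, ← hS, eq_top_iff]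
  exact fun z _ => isTotal_vecTensor_univ.le_topologicalClosure hc (fun p => h2 p.1 p.2) z

theorem clm_ext_vecTensor {f g : HilbertTensor H K →L[ℂ] G}
    (h : ∀ x y, f (vecTensor x y) = g (vecTensor x y)) : f = g :=
  isTotal_vecTensor_univ.clm_ext fun p => h p.1 p.2

/-- Equal Gram matrices give each finite linear combination the same norm on both sides, so linear
independence is not needed. Every unitary below is built this way. -/
theorem IsTotal.exists_linearIsometryEquiv [CompleteSpace H] [CompleteSpace G]
    {ι : Type*} {v : ι → H} {w : ι → G} (hv : IsTotal v) (hw : IsTotal w)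
    (h : ∀ i j, ⟪w i, w j⟫_ℂ = ⟪v i, v j⟫_ℂ) :
    ∃ e : H ≃ₗᵢ[ℂ] G, ∀ i, e (v i) = w i := by
  have hv' : DenseRange (Finsupp.linearCombination ℂ v) := by
    rwa [DenseRange, ← LinearMap.coe_range, Finsupp.range_linearCombination]
  have hw' : DenseRange (Finsupp.linearCombination ℂ w) := by
    rwa [DenseRange, ← LinearMap.coe_range, Finsupp.range_linearCombination]
  have hinner : ∀ c : ι →₀ ℂ,
      ⟪Finsupp.linearCombination ℂ w c, Finsupp.linearCombination ℂ w c⟫_ℂ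
        = ⟪Finsupp.linearCombination ℂ v c, Finsupp.linearCombination ℂ v c⟫_ℂ := by
    intro c
    simp only [Finsupp.linearCombination_apply, Finsupp.sum, sum_inner, inner_sum,
      inner_smul_left, inner_smul_right, h]
  have hnorm : ∀ c : ι →₀ ℂ, ‖Finsupp.linearCombination ℂ w (LinearEquiv.refl ℂ _ c)‖
      = ‖Finsupp.linearCombination ℂ v c‖ := by
    intro c
    rw [LinearEquiv.refl_apply, @norm_eq_sqrt_re_inner ℂ, @norm_eq_sqrt_re_inner ℂ, hinner]
  -- The identity on coefficients is extended along the two dense-range maps `ι →₀ ℂ → H` and `ι →₀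
  -- ℂ → G`.
  refine ⟨(LinearEquiv.refl ℂ (ι →₀ ℂ)).extendOfIsometry _ _ hv' hw' hnorm, fun i => ?_⟩
  have := LinearEquiv.extendOfIsometry_eq (LinearEquiv.refl ℂ (ι →₀ ℂ)) _ _
    hv' hw' hnorm (Finsupp.single i 1)
  simpa using this

end Total

/-! ### Algebra of operator tensors and the ampliations. -/

section Ampliation

variable {H : Type u} {K : Type v}
  [NormedAddCommGroup H] [InnerProductSpace ℂ H]
  [NormedAddCommGroup K] [InnerProductSpace ℂ K]

theorem opTensor_mul (a a' : H →L[ℂ] H) (b b' : K →L[ℂ] K) :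
    opTensor (a * a') (b * b') = opTensor a b * opTensor a' b' :=
  clm_ext_vecTensor fun x y => by simp [opTensor_vecTensor]

theorem opTensor_one : opTensor (1 : H →L[ℂ] H) (1 : K →L[ℂ] K) = 1 :=
  clm_ext_vecTensor fun x y => by simp [opTensor_vecTensor]

theorem opTensor_add_left (a a' : H →L[ℂ] H) (b : K →L[ℂ] K) :
    opTensor (a + a') b = opTensor a b + opTensor a' b :=
  clm_ext_vecTensor fun x y => by
    simp only [opTensor_vecTensor, add_apply]
    exact map_add (vecTensorRight (b y)) (a x) (a' x)

theorem opTensor_add_right (a : H →L[ℂ] H) (b b' : K →L[ℂ] K) :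
    opTensor a (b + b') = opTensor a b + opTensor a b' :=
  clm_ext_vecTensor fun x y => by
    simp only [opTensor_vecTensor, add_apply]
    exact map_add (vecTensorLeft (a x)) (b y) (b' y)

theorem opTensor_smul_left (c : ℂ) (a : H →L[ℂ] H) (b : K →L[ℂ] K) :
    opTensor (c • a) b = c • opTensor a b :=
  clm_ext_vecTensor fun x y => by
    simp only [opTensor_vecTensor, smul_apply]
    exact map_smul (vecTensorRight (b y)) c (a x)

theorem opTensor_smul_right (c : ℂ) (a : H →L[ℂ] H) (b : K →L[ℂ] K) :
    opTensor a (c • b) = c • opTensor a b :=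
  clm_ext_vecTensor fun x y => by
    simp only [opTensor_vecTensor, smul_apply]
    exact map_smul (vecTensorLeft (a x)) c (b y)

variable [CompleteSpace H] [CompleteSpace K]

theorem star_opTensor (a : H →L[ℂ] H) (b : K →L[ℂ] K) :
    star (opTensor a b) = opTensor (star a) (star b) := by
  refine clm_ext_vecTensor fun x y => ?_
  -- As functionals of the second argument of the inner product, both sides are continuous and
  -- linear, so elementary tensors suffice there too.
  have key : innerSL ℂ (star (opTensor a b) (vecTensor x y))
      = innerSL ℂ (opTensor (star a) (star b) (vecTensor x y)) := by
    refine clm_ext_vecTensor fun x' y' => ?_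
    simp only [innerSL_apply_apply, ContinuousLinearMap.star_eq_adjoint,
      ContinuousLinearMap.adjoint_inner_left, opTensor_vecTensor, inner_vecTensor]
  exact ext_inner_right ℂ fun z => congrArg (fun f => f z) key

/-- The ampliation `a ↦ a ⊗ 1`. -/
def amplLeft (H : Type u) (K : Type v)
    [NormedAddCommGroup H] [InnerProductSpace ℂ H] [CompleteSpace H]
    [NormedAddCommGroup K] [InnerProductSpace ℂ K] [CompleteSpace K] :
    (H →L[ℂ] H) →⋆ₐ[ℂ] (HilbertTensor H K →L[ℂ] HilbertTensor H K) where
  toFun a := opTensor a 1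
  map_one' := opTensor_one
  map_mul' a b := by rw [← opTensor_mul, one_mul]
  map_zero' := by simpa using opTensor_smul_left (0 : ℂ) (0 : H →L[ℂ] H) (1 : K →L[ℂ] K)
  map_add' a b := opTensor_add_left a b 1
  commutes' c := by
    rw [Algebra.algebraMap_eq_smul_one, opTensor_smul_left, opTensor_one,
      Algebra.algebraMap_eq_smul_one]
  map_star' a := by rw [star_opTensor, star_one]

/-- The ampliation `b ↦ 1 ⊗ b`. -/
def amplRight (H : Type u) (K : Type v)
    [NormedAddCommGroup H] [InnerProductSpace ℂ H] [CompleteSpace H]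
    [NormedAddCommGroup K] [InnerProductSpace ℂ K] [CompleteSpace K] :
    (K →L[ℂ] K) →⋆ₐ[ℂ] (HilbertTensor H K →L[ℂ] HilbertTensor H K) where
  toFun b := opTensor 1 b
  map_one' := opTensor_one
  map_mul' a b := by rw [← opTensor_mul, one_mul]
  map_zero' := by simpa using opTensor_smul_right (0 : ℂ) (1 : H →L[ℂ] H) (0 : K →L[ℂ] K)
  map_add' a b := opTensor_add_right 1 a b
  commutes' c := by
    rw [Algebra.algebraMap_eq_smul_one, opTensor_smul_right, opTensor_one,
      Algebra.algebraMap_eq_smul_one]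
  map_star' a := by rw [star_opTensor, star_one]

theorem amplLeft_apply (a : H →L[ℂ] H) : amplLeft H K a = opTensor a 1 := rfl

/-- For a fixed `y ≠ 0`, `a x ⊗ y = 0` forces `‖a x‖² ‖y‖² = 0`. -/
theorem amplLeft_injective [Nontrivial K] : Function.Injective (amplLeft H K) := by
  obtain ⟨y, hy⟩ := exists_ne (0 : K)
  refine (injective_iff_map_eq_zero _).2 fun a ha => ContinuousLinearMap.ext fun x => ?_
  have h : vecTensor (a x) y = 0 := by
    have := congrArg (fun f => f (vecTensor x y)) ha
    simpa [amplLeft_apply, opTensor_vecTensor] using this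
  have h2 := inner_vecTensor (a x) (a x) y y
  rw [h, inner_zero_left] at h2
  simpa [hy] using h2.symm

end Ampliation

/-! ### Homomorphisms restricted to closed *-subalgebras. -/

section Closure

variable {H : Type u} {K : Type v}
  [NormedAddCommGroup H] [InnerProductSpace ℂ H] [CompleteSpace H]
  [NormedAddCommGroup K] [InnerProductSpace ℂ K] [CompleteSpace K]

/-- *-homomorphisms of C*-algebras are contractive, so the preimage of `B` is a closed *-subalgebra
containing the generators. -/
theorem map_mem_of_mem_closure_adjoin {𝔄 𝔅 : Type*} [CStarAlgebra 𝔄] [CStarAlgebra 𝔅]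
    (φ : 𝔄 →⋆ₐ[ℂ] 𝔅) {s : Set 𝔄} {B : StarSubalgebra ℂ 𝔅} (hB : IsClosed (B : Set 𝔅))
    (h : ∀ a ∈ s, φ a ∈ B) {a : 𝔄} (ha : a ∈ (StarAlgebra.adjoin ℂ s).topologicalClosure) :
    φ a ∈ B := by
  have hφ : Continuous φ := AddMonoidHomClass.continuous_of_bound φ 1
      (fun x => by simpa using NonUnitalStarAlgHom.norm_apply_le φ x)
  exact StarSubalgebra.topologicalClosure_minimal (t := B.comap φ)
    (StarAlgebra.adjoin_le h) (hB.preimage hφ) ha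

theorem isClosed_minTensor (A : StarSubalgebra ℂ (H →L[ℂ] H))
    (B : StarSubalgebra ℂ (K →L[ℂ] K)) :
    IsClosed (minTensor A B : Set (HilbertTensor H K →L[ℂ] HilbertTensor H K)) :=
  StarSubalgebra.isClosed_topologicalClosure _

theorem opTensor_mem_minTensor {A : StarSubalgebra ℂ (H →L[ℂ] H)}
    {B : StarSubalgebra ℂ (K →L[ℂ] K)} {a : H →L[ℂ] H} {b : K →L[ℂ] K} (ha : a ∈ A)
    (hb : b ∈ B) : opTensor a b ∈ minTensor A B :=
  (elemTensor (⟨a, ha⟩ : A) (⟨b, hb⟩ : B)).2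

/-- A *-homomorphism between operator algebras that maps elementary tensors over `A` and `B` into
the closed *-subalgebra `C` maps the minimal tensor product into `C`. -/
theorem map_mem_of_mem_minTensor {𝔅 : Type*} [CStarAlgebra 𝔅]
    {A : StarSubalgebra ℂ (H →L[ℂ] H)} {B : StarSubalgebra ℂ (K →L[ℂ] K)}
    {C : StarSubalgebra ℂ 𝔅} (hC : IsClosed (C : Set 𝔅))
    (φ : (HilbertTensor H K →L[ℂ] HilbertTensor H K) →⋆ₐ[ℂ] 𝔅)
    (h : ∀ a ∈ A, ∀ b ∈ B, φ (opTensor a b) ∈ C)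
    {x : HilbertTensor H K →L[ℂ] HilbertTensor H K} (hx : x ∈ minTensor A B) : φ x ∈ C :=
  map_mem_of_mem_closure_adjoin φ hC (by rintro _ ⟨a, ha, b, hb, rfl⟩; exact h a ha b hb) hx

/-- Restriction of a *-homomorphism to *-subalgebras. -/
def restrictHom {𝔄 𝔅 : Type*} [CStarAlgebra 𝔄] [CStarAlgebra 𝔅] (φ : 𝔄 →⋆ₐ[ℂ] 𝔅)
    (A : StarSubalgebra ℂ 𝔄) (B : StarSubalgebra ℂ 𝔅) (h : ∀ a ∈ A, φ a ∈ B) : A →⋆ₐ[ℂ] B :=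
  (φ.comp A.subtype).codRestrict B fun a => h a a.2

/-- Restriction of a *-isomorphism to *-subalgebras that correspond to each other. -/
def restrictEquiv {𝔄 𝔅 : Type*} [CStarAlgebra 𝔄] [CStarAlgebra 𝔅] (φ : 𝔄 ≃⋆ₐ[ℂ] 𝔅)
    (A : StarSubalgebra ℂ 𝔄) (B : StarSubalgebra ℂ 𝔅) (h : ∀ a ∈ A, φ a ∈ B)
    (h' : ∀ b ∈ B, φ.symm b ∈ A) : A ≃⋆ₐ[ℂ] B where
  toFun a := ⟨φ a, h a a.2⟩
  invFun b := ⟨φ.symm b, h' b b.2⟩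
  left_inv a := Subtype.ext (φ.symm_apply_apply a)
  right_inv b := Subtype.ext (φ.apply_symm_apply b)
  map_mul' _ _ := Subtype.ext (map_mul φ _ _)
  map_add' _ _ := Subtype.ext (map_add φ _ _)
  map_star' _ := Subtype.ext (map_star φ _)
  map_smul' c _ := Subtype.ext (map_smul φ c _)

end Closure

/-! ### Unitaries that rearrange tensor factors. -/

section Unitaries

variable {H K L : Type*}
  [NormedAddCommGroup H] [InnerProductSpace ℂ H]
  [NormedAddCommGroup K] [InnerProductSpace ℂ K]
  [NormedAddCommGroup L] [InnerProductSpace ℂ L]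

theorem exists_flip_unitary : ∃ e : HilbertTensor H K ≃ₗᵢ[ℂ] HilbertTensor K H,
    ∀ x y, e (vecTensor x y) = vecTensor y x := by
  have hw : IsTotal (fun p : H × K => vecTensor p.2 p.1) := by
    refine (isTotal_vecTensor_univ (H := K) (K := H)).mono (Submodule.span_mono ?_)
    rintro _ ⟨p, rfl⟩
    exact ⟨p.swap, rfl⟩
  obtain ⟨e, he⟩ := (isTotal_vecTensor_univ (H := H) (K := K)).exists_linearIsometryEquiv hw
    fun p q => by rw [inner_vecTensor, inner_vecTensor, mul_comm]
  exact ⟨e, fun x y => he (x, y)⟩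

theorem isTotal_vecTensor_vecTensor (H K L : Type*)
    [NormedAddCommGroup H] [InnerProductSpace ℂ H]
    [NormedAddCommGroup K] [InnerProductSpace ℂ K]
    [NormedAddCommGroup L] [InnerProductSpace ℂ L] : IsTotal
    (fun p : (H × K) × L => vecTensor (vecTensor p.1.1 p.1.2) p.2) := by
  have h := IsTotal.vecTensor (isTotal_vecTensor_univ (H := H) (K := K)) (IsTotal.id (H := L))
  exact h

theorem exists_assoc_unitary :
    ∃ e : HilbertTensor (HilbertTensor H K) L ≃ₗᵢ[ℂ] HilbertTensor H (HilbertTensor K L),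
      ∀ x y z, e (vecTensor (vecTensor x y) z) = vecTensor x (vecTensor y z) := by
  have hw : IsTotal (fun p : (H × K) × L => vecTensor p.1.1 (vecTensor p.1.2 p.2)) := by
    have h := IsTotal.vecTensor (IsTotal.id (H := H)) (isTotal_vecTensor_univ (H := K) (K := L))
    refine h.mono (Submodule.span_mono ?_)
    rintro _ ⟨p, rfl⟩
    exact ⟨((p.1, p.2.1), p.2.2), rfl⟩
  obtain ⟨e, he⟩ := (isTotal_vecTensor_vecTensor H K L).exists_linearIsometryEquiv hw
    fun p q => by simp only [inner_vecTensor, mul_assoc]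
  exact ⟨e, fun x y z => he ((x, y), z)⟩

variable {M : Type*} [NormedAddCommGroup M] [InnerProductSpace ℂ M]

/-- The unitary `(x ⊗ y) ⊗ l ↦ U (x ⊗ l) ⊗ y`. -/
theorem exists_unitary_tensor_id (U : HilbertTensor H L ≃ₗᵢ[ℂ] M) :
    ∃ e : HilbertTensor (HilbertTensor H K) L ≃ₗᵢ[ℂ] HilbertTensor M K,
      ∀ x y l, e (vecTensor (vecTensor x y) l) = vecTensor (U (vecTensor x l)) y := by
  have hw : IsTotal (fun p : (H × K) × L => vecTensor (U (vecTensor p.1.1 p.2)) p.1.2) := by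
    have h := IsTotal.vecTensor ((isTotal_vecTensor_univ (H := H) (K := L)).map U)
      (IsTotal.id (H := K))
    refine h.mono (Submodule.span_mono ?_)
    rintro _ ⟨p, rfl⟩
    exact ⟨((p.1.1, p.2), p.1.2), rfl⟩
  obtain ⟨e, he⟩ := (isTotal_vecTensor_vecTensor H K L).exists_linearIsometryEquiv hw
    fun p q => by
      simp only [inner_vecTensor, LinearIsometryEquiv.inner_map_map, mul_right_comm]
  exact ⟨e, fun x y z => he ((x, y), z)⟩

/-- The unitary `(x ⊗ y) ⊗ l ↦ x ⊗ U (y ⊗ l)`. -/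
theorem exists_unitary_id_tensor (U : HilbertTensor K L ≃ₗᵢ[ℂ] M) :
    ∃ e : HilbertTensor (HilbertTensor H K) L ≃ₗᵢ[ℂ] HilbertTensor H M,
      ∀ x y l, e (vecTensor (vecTensor x y) l) = vecTensor x (U (vecTensor y l)) := by
  have hw : IsTotal (fun p : (H × K) × L => vecTensor p.1.1 (U (vecTensor p.1.2 p.2))) := by
    have h := IsTotal.vecTensor (IsTotal.id (H := H))
      ((isTotal_vecTensor_univ (H := K) (K := L)).map U)
    refine h.mono (Submodule.span_mono ?_)
    rintro _ ⟨p, rfl⟩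
    exact ⟨((p.1, p.2.1), p.2.2), rfl⟩
  obtain ⟨e, he⟩ := (isTotal_vecTensor_vecTensor H K L).exists_linearIsometryEquiv hw
    fun p q => by
      simp only [inner_vecTensor, LinearIsometryEquiv.inner_map_map, mul_assoc]
  exact ⟨e, fun x y z => he ((x, y), z)⟩

theorem conj_eq_of_isTotal [CompleteSpace H] [CompleteSpace M]
    {ι : Type*} {v : ι → H} (hv : IsTotal v)
    (e : H ≃ₗᵢ[ℂ] M) {a : H →L[ℂ] H} {b : M →L[ℂ] M} (h : ∀ i, e (a (v i)) = b (e (v i))) :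
    e.conjStarAlgEquiv a = b :=
  (hv.map e).clm_ext fun i => by simp [h]

end Unitaries

/-! ### Tensoring a spatially implemented homomorphism with the identity. -/

section TensorHom

variable {H K L M : Type*}
  [NormedAddCommGroup H] [InnerProductSpace ℂ H] [CompleteSpace H]
  [NormedAddCommGroup K] [InnerProductSpace ℂ K] [CompleteSpace K]
  [NormedAddCommGroup L] [InnerProductSpace ℂ L] [CompleteSpace L]
  [NormedAddCommGroup M] [InnerProductSpace ℂ M] [CompleteSpace M]

/-- The *-homomorphism `a ↦ U (a ⊗ 1) U*`. -/
def conjAmpl (U : HilbertTensor H L ≃ₗᵢ[ℂ] M) : (H →L[ℂ] H) →⋆ₐ[ℂ] (M →L[ℂ] M) :=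
  U.conjStarAlgEquiv.toStarAlgHom.comp (amplLeft H L)

theorem conjAmpl_apply (U : HilbertTensor H L ≃ₗᵢ[ℂ] M) (a : H →L[ℂ] H) :
    conjAmpl U a = U.conjStarAlgEquiv (opTensor a 1) := rfl

theorem conjAmpl_injective [Nontrivial L] (U : HilbertTensor H L ≃ₗᵢ[ℂ] M) :
    Function.Injective (conjAmpl U) :=
  U.conjStarAlgEquiv.injective.comp amplLeft_injective

theorem conjAmpl_eq_of_isTotal {ι : Type*} {v : ι → HilbertTensor H L} (hv : IsTotal v)
    (U : HilbertTensor H L ≃ₗᵢ[ℂ] M) {a : H →L[ℂ] H} {b : M →L[ℂ] M}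
    (h : ∀ i, U (opTensor a 1 (v i)) = b (U (v i))) : conjAmpl U a = b :=
  conj_eq_of_isTotal hv U h

/-- If `φ` is `a ↦ U (a ⊗ 1) U*`, then `φ ⊗ id` has the same form on `H ⊗ K`: the auxiliary factor
`L` is carried past `K` to meet `H` before `U` is applied. -/
theorem exists_isTensorHom_id {A : StarSubalgebra ℂ (H →L[ℂ] H)}
    {B : StarSubalgebra ℂ (M →L[ℂ] M)} (C : StarSubalgebra ℂ (K →L[ℂ] K)) (φ : A →⋆ₐ[ℂ] B)
    (U : HilbertTensor H L ≃ₗᵢ[ℂ] M) (hφ : ∀ a : A, (φ a : M →L[ℂ] M) = conjAmpl U a) :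
    ∃ Φ : minTensor A C →⋆ₐ[ℂ] minTensor B C, IsTensorHom φ (StarAlgHom.id ℂ C) Φ := by
  obtain ⟨e, he⟩ := exists_unitary_tensor_id (K := K) U
  have key : ∀ (a : H →L[ℂ] H) (b : K →L[ℂ] K),
      conjAmpl e (opTensor a b) = opTensor (conjAmpl U a) b := fun a b =>
    conjAmpl_eq_of_isTotal (isTotal_vecTensor_vecTensor H K L) e fun p => by
      simp [opTensor_vecTensor, he, conjAmpl_apply]
  refine ⟨restrictHom (conjAmpl e) _ _ fun x hx =>
    map_mem_of_mem_minTensor (isClosed_minTensor B C) _ (fun a ha b hb => ?_) hx,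
    fun a b => Subtype.ext ?_⟩
  · rw [key, ← hφ ⟨a, ha⟩]
    exact opTensor_mem_minTensor (φ ⟨a, ha⟩).2 hb
  · refine (key a b).trans ?_
    rw [← hφ]
    rfl

theorem exists_id_isTensorHom {A : StarSubalgebra ℂ (K →L[ℂ] K)}
    {B : StarSubalgebra ℂ (M →L[ℂ] M)} (C : StarSubalgebra ℂ (H →L[ℂ] H)) (φ : A →⋆ₐ[ℂ] B)
    (U : HilbertTensor K L ≃ₗᵢ[ℂ] M) (hφ : ∀ a : A, (φ a : M →L[ℂ] M) = conjAmpl U a) :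
    ∃ Φ : minTensor C A →⋆ₐ[ℂ] minTensor C B, IsTensorHom (StarAlgHom.id ℂ C) φ Φ := by
  obtain ⟨e, he⟩ := exists_unitary_id_tensor (H := H) U
  have key : ∀ (a : H →L[ℂ] H) (b : K →L[ℂ] K),
      conjAmpl e (opTensor a b) = opTensor a (conjAmpl U b) := fun a b =>
    conjAmpl_eq_of_isTotal (isTotal_vecTensor_vecTensor H K L) e fun p => by
      simp [opTensor_vecTensor, he, conjAmpl_apply]
  refine ⟨restrictHom (conjAmpl e) _ _ fun x hx =>
    map_mem_of_mem_minTensor (isClosed_minTensor C B) _ (fun a ha b hb => ?_) hx,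
    fun a b => Subtype.ext ?_⟩
  · rw [key, ← hφ ⟨b, hb⟩]
    exact opTensor_mem_minTensor ha (φ ⟨b, hb⟩).2
  · refine (key a b).trans ?_
    rw [← hφ]
    rfl

end TensorHom

/-! ### Flip, associator, and the reduction to a group-like generator. -/

section FlipAssociator

variable {H : Type*} [NormedAddCommGroup H] [InnerProductSpace ℂ H] [CompleteSpace H]

theorem exists_isFlip (A : StarSubalgebra ℂ (H →L[ℂ] H)) :
    ∃ σ : minTensor A A ≃⋆ₐ[ℂ] minTensor A A, IsFlip σ := by
  obtain ⟨e, he⟩ := exists_flip_unitary (H := H) (K := H)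
  have key : ∀ a b : H →L[ℂ] H, e.conjStarAlgEquiv (opTensor a b) = opTensor b a := fun a b =>
    conj_eq_of_isTotal isTotal_vecTensor_univ e fun p => by simp [opTensor_vecTensor, he]
  have key' : ∀ a b : H →L[ℂ] H, e.conjStarAlgEquiv.symm (opTensor a b) = opTensor b a :=
    fun a b => by rw [← key b a, StarAlgEquiv.symm_apply_apply]
  refine ⟨restrictEquiv e.conjStarAlgEquiv _ _ (fun x hx => ?_) (fun x hx => ?_),
    fun a b => Subtype.ext (key a b)⟩
  · refine map_mem_of_mem_minTensor (isClosed_minTensor A A)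
      e.conjStarAlgEquiv.toStarAlgHom (fun a ha b hb => ?_) hx
    exact (key a b).symm ▸ opTensor_mem_minTensor hb ha
  · refine map_mem_of_mem_minTensor (isClosed_minTensor A A)
      e.conjStarAlgEquiv.symm.toStarAlgHom (fun a ha b hb => ?_) hx
    exact (key' a b).symm ▸ opTensor_mem_minTensor hb ha

theorem exists_isAssociator (A : StarSubalgebra ℂ (H →L[ℂ] H)) :
    ∃ α : minTensor (minTensor A A) A ≃⋆ₐ[ℂ] minTensor A (minTensor A A), IsAssociator α := by
  obtain ⟨e, he⟩ := exists_assoc_unitary (H := H) (K := H) (L := H)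
  have key : ∀ a b c : H →L[ℂ] H,
      e.conjStarAlgEquiv (opTensor (opTensor a b) c) = opTensor a (opTensor b c) :=
    fun a b c => conj_eq_of_isTotal (isTotal_vecTensor_vecTensor H H H) e fun p => by
      simp [opTensor_vecTensor, he]
  have key' : ∀ a b c : H →L[ℂ] H,
      e.conjStarAlgEquiv.symm (opTensor a (opTensor b c)) = opTensor (opTensor a b) c :=
    fun a b c => by rw [← key a b c, StarAlgEquiv.symm_apply_apply]
  -- Written as `1 ⊗ 1`, the identity falls under `key` and `key'`.
  have hone : (1 : HilbertTensor H H →L[ℂ] HilbertTensor H H) = opTensor 1 1 :=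
    opTensor_one.symm
  refine ⟨restrictEquiv e.conjStarAlgEquiv _ _ (fun x hx => ?_) (fun x hx => ?_),
    fun a b c => Subtype.ext (key a b c)⟩
  · refine map_mem_of_mem_minTensor (isClosed_minTensor A (minTensor A A))
      e.conjStarAlgEquiv.toStarAlgHom (fun z hz c hc => ?_) hx
    -- A general `z` in `minTensor A A` is not elementary, so `key` does not apply. After factoring,
    -- `z ↦ z ⊗ 1` is a *-homomorphism, and the membership can be tested on elementary `z`.
    have h1 : opTensor z c = opTensor z 1 * opTensor 1 c := by
      rw [← opTensor_mul, mul_one, one_mul]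
    rw [h1, map_mul]
    refine mul_mem ?_ ?_
    · refine map_mem_of_mem_minTensor (isClosed_minTensor A (minTensor A A))
        (e.conjStarAlgEquiv.toStarAlgHom.comp (amplLeft (HilbertTensor H H) H))
        (fun a ha b hb => ?_) hz
      exact (key a b 1).symm ▸ opTensor_mem_minTensor ha (opTensor_mem_minTensor hb (one_mem A))
    · rw [hone]
      exact (key 1 1 c).symm ▸
        opTensor_mem_minTensor (one_mem A) (opTensor_mem_minTensor (one_mem A) hc)
  · refine map_mem_of_mem_minTensor (isClosed_minTensor (minTensor A A) A)
      e.conjStarAlgEquiv.symm.toStarAlgHom (fun a ha z hz => ?_) hx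
    have h1 : opTensor a z = opTensor a 1 * opTensor 1 z := by
      rw [← opTensor_mul, mul_one, one_mul]
    rw [h1, map_mul]
    refine mul_mem ?_ ?_
    · rw [hone]
      exact (key' a 1 1).symm ▸
        opTensor_mem_minTensor (opTensor_mem_minTensor ha (one_mem A)) (one_mem A)
    · refine map_mem_of_mem_minTensor (isClosed_minTensor (minTensor A A) A)
        (e.conjStarAlgEquiv.symm.toStarAlgHom.comp (amplRight H (HilbertTensor H H)))
        (fun b hb c hc => ?_) hz
      exact (key' 1 b c).symm ▸ opTensor_mem_minTensor (opTensor_mem_minTensor (one_mem A) hb) hc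

theorem elemTensor_mul {A : StarSubalgebra ℂ (H →L[ℂ] H)} (a b c d : A) :
    elemTensor (A := A) (B := A) (a * b) (c * d) = elemTensor a c * elemTensor b d :=
  Subtype.ext (opTensor_mul _ _ _ _)

theorem elemTensor_pow {A : StarSubalgebra ℂ (H →L[ℂ] H)} (a b : A) (n : ℕ) :
    elemTensor (A := A) (B := A) (a ^ n) (b ^ n) = elemTensor a b ^ n := by
  induction n with
  | zero => simpa using Subtype.ext opTensor_one
  | succ n ih => rw [pow_succ, pow_succ, pow_succ, elemTensor_mul, ih]

theorem star_elemTensor {A : StarSubalgebra ℂ (H →L[ℂ] H)} (a b : A) :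
    star (elemTensor (A := A) (B := A) a b) = elemTensor (star a) (star b) :=
  Subtype.ext (star_opTensor _ _)

/-- Both sides are `t ⊗ (t ⊗ t)`. -/
theorem IsAssociator.apply_of_grouplike {A : StarSubalgebra ℂ (H →L[ℂ] H)}
    {Δ : A →⋆ₐ[ℂ] minTensor A A} {t : A} (ht : Δ t = elemTensor t t)
    {Φ : minTensor A A →⋆ₐ[ℂ] minTensor (minTensor A A) A}
    {Ψ : minTensor A A →⋆ₐ[ℂ] minTensor A (minTensor A A)}
    {α : minTensor (minTensor A A) A ≃⋆ₐ[ℂ] minTensor A (minTensor A A)}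
    (hα : IsAssociator α) (hΦ : IsTensorHom Δ (StarAlgHom.id ℂ A) Φ)
    (hΨ : IsTensorHom (StarAlgHom.id ℂ A) Δ Ψ) : α (Φ (Δ t)) = Ψ (Δ t) := by
  have h1 : Φ (Δ t) = elemTensor (elemTensor t t) t := by
    rw [ht, hΦ t t, ht]; rfl
  have h2 : Ψ (Δ t) = elemTensor t (elemTensor t t) := by
    rw [ht, hΨ t t, ht]; rfl
  rw [h1, h2]
  exact hα t t t

/-- Coassociativity holds if the compositions agree at a group-like element by whose image any
*-homomorphism on `A` is determined. -/
theorem coassociative_of_grouplike {A : StarSubalgebra ℂ (H →L[ℂ] H)}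
    {Δ : A →⋆ₐ[ℂ] minTensor A A} {t : A} (ht : Δ t = elemTensor t t)
    (hext : ∀ Φ Ψ : A →⋆ₐ[ℂ] minTensor A (minTensor A A), Φ t = Ψ t → Φ = Ψ)
    {L : Type*} [NormedAddCommGroup L] [InnerProductSpace ℂ L] [CompleteSpace L]
    (U : HilbertTensor H L ≃ₗᵢ[ℂ] HilbertTensor H H)
    (hU : ∀ a : A, (Δ a : HilbertTensor H H →L[ℂ] HilbertTensor H H) = conjAmpl U a) :
    Coassociative Δ := by
  obtain ⟨Φ, hΦ⟩ := exists_isTensorHom_id A Δ U hU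
  obtain ⟨Ψ, hΨ⟩ := exists_id_isTensorHom A Δ U hU
  obtain ⟨α, hα⟩ := exists_isAssociator A
  refine ⟨Φ, Ψ, α, hΦ, hΨ, hα, fun a => ?_⟩
  have h := hext ((α.toStarAlgHom.comp Φ).comp Δ) (Ψ.comp Δ) (hα.apply_of_grouplike ht hΦ hΨ)
  exact DFunLike.congr_fun h a

theorem cocommutative_of_grouplike {A : StarSubalgebra ℂ (H →L[ℂ] H)}
    {Δ : A →⋆ₐ[ℂ] minTensor A A} {t : A} (ht : Δ t = elemTensor t t)
    (hext : ∀ Φ Ψ : A →⋆ₐ[ℂ] minTensor A A, Φ t = Ψ t → Φ = Ψ) : Cocommutative Δ := by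
  obtain ⟨σ, hσ⟩ := exists_isFlip A
  refine ⟨σ, hσ, fun a => ?_⟩
  have h1 : σ (Δ t) = Δ t := by rw [ht, hσ]
  exact DFunLike.congr_fun (hext (σ.toStarAlgHom.comp Δ) Δ h1) a

end FlipAssociator

/-! ### The diagonal unitary and rigidity of the Toeplitz algebra. -/

section Toeplitz

theorem isTotal_single (ι : Type*) [DecidableEq ι] :
    IsTotal (fun i : ι => (lp.single 2 i (1 : ℂ) : lp (fun _ : ι => ℂ) 2)) :=
  (Submodule.dense_iff_topologicalClosure_eq_top).2 <| by
    set b := HilbertBasis.ofRepr (LinearIsometryEquiv.refl ℂ (lp (fun _ : ι => ℂ) 2)) with hb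
    have h : ∀ i, b i = lp.single 2 i (1 : ℂ) := fun i => by
      rw [← b.repr_symm_single, hb]
      rfl
    rw [← funext h]
    exact b.dense_span

/-- Needed for `ℓ²(ℤ)`, so that `conjAmpl_injective` applies to the diagonal unitary. -/
instance nontrivial_lp (ι : Type*) [Nonempty ι] : Nontrivial (lp (fun _ : ι => ℂ) 2) := by
  classical
  refine ⟨lp.single 2 (Classical.arbitrary ι) (1 : ℂ), 0, fun h => ?_⟩
  simpa using congrArg (fun f : lp (fun _ : ι => ℂ) 2 => f (Classical.arbitrary ι)) h

theorem inner_single_single {ι : Type*} [DecidableEq ι] (i j : ι) :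
    ⟪(lp.single 2 i (1 : ℂ) : lp (fun _ : ι => ℂ) 2), lp.single 2 j (1 : ℂ)⟫_ℂ
      = if i = j then 1 else 0 := by
  rw [lp.inner_single_left]
  by_cases h : i = j
  · subst h; simp
  · simp [h, lp.single_apply]

/-- The unitary `ℓ²(ℕ) ⊗ ℓ²(ℤ) → ℓ²(ℕ) ⊗ ℓ²(ℕ)` that intertwines `T ⊗ 1` and `T ⊗ T`. -/
theorem exists_diagonal_unitary :
    ∃ U : HilbertTensor EllTwo (lp (fun _ : ℤ => ℂ) 2) ≃ₗᵢ[ℂ] HilbertTensor EllTwo EllTwo,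
      ∀ (k : ℕ) (d : ℤ), U (vecTensor (lp.single 2 k (1 : ℂ)) (lp.single 2 d (1 : ℂ)))
        = vecTensor (lp.single 2 (k + d.toNat) (1 : ℂ))
            (lp.single 2 (k + (-d).toNat) (1 : ℂ)) := by
  have hw : IsTotal (fun p : ℕ × ℤ =>
      (vecTensor (lp.single 2 (p.1 + p.2.toNat) (1 : ℂ))
        (lp.single 2 (p.1 + (-p.2).toNat) (1 : ℂ)) : HilbertTensor EllTwo EllTwo)) := by
    refine ((isTotal_single ℕ).vecTensor (isTotal_single ℕ)).mono (Submodule.span_mono ?_)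
    rintro _ ⟨⟨i, j⟩, rfl⟩
    -- The basis vector `e_i ⊗ e_j` sits on diagonal `i - j`, at distance `min i j` from its
    -- starting point.
    refine ⟨(min i j, (i : ℤ) - j), ?_⟩
    have h1 : min i j + ((i : ℤ) - j).toNat = i := by omega
    have h2 : min i j + (-((i : ℤ) - j)).toNat = j := by omega
    simp only [h1, h2]
  obtain ⟨U, hU⟩ := ((isTotal_single ℕ).vecTensor (isTotal_single ℤ)).exists_linearIsometryEquiv
    hw fun p q => by
      simp only [inner_vecTensor, inner_single_single]
      by_cases h : p = q
      · simp [h]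
      -- One of `d.toNat`, `(-d).toNat` vanishes and their difference is `d`, so the two indices
      -- determine `(k, d)`; distinct pairs give orthogonal vectors.
      · have h1 : ¬ (p.1 + p.2.toNat = q.1 + q.2.toNat ∧
            p.1 + (-p.2).toNat = q.1 + (-q.2).toNat) := fun h' => h (Prod.ext (by omega) (by omega))
        have h2 : ¬ (p.1 = q.1 ∧ p.2 = q.2) := fun h' => h (Prod.ext h'.1 h'.2)
        simp only [mul_ite, mul_one, mul_zero, ← ite_and]
        rw [if_neg (by tauto), if_neg (by tauto)]
  exact ⟨U, fun k d => hU (k, d)⟩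

/-- Composing with the inclusion of `B` gives maps into a C*-algebra, which lets
`starAlgHom_ext_closure` apply without `B` being closed. -/
theorem toeplitz_hom_ext {𝔅 : Type*} [CStarAlgebra 𝔅] {B : StarSubalgebra ℂ 𝔅}
    {Φ Ψ : toeplitz →⋆ₐ[ℂ] B} (h : Φ toeplitzT = Ψ toeplitzT) : Φ = Ψ := by
  have key : B.subtype.comp Φ = B.subtype.comp Ψ := by
    refine starAlgHom_ext_closure {shift} ?_
    rintro y rfl
    exact congrArg B.subtype h
  exact StarAlgHom.ext fun x => Subtype.ext (congrArg (fun f : toeplitz →⋆ₐ[ℂ] 𝔅 => f x) key)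

end Toeplitz

end QSemigroup

end

/-! ### The comultiplication and its properties. -/

theorem theorem4 :
    ∃ Δ : QSemigroup.toeplitz →⋆ₐ[ℂ]
        QSemigroup.minTensor QSemigroup.toeplitz QSemigroup.toeplitz,
      Δ QSemigroup.toeplitzT
          = QSemigroup.elemTensor QSemigroup.toeplitzT QSemigroup.toeplitzT ∧
      (∀ Δ' : QSemigroup.toeplitz →⋆ₐ[ℂ]
          QSemigroup.minTensor QSemigroup.toeplitz QSemigroup.toeplitz,
        Δ' QSemigroup.toeplitzT
            = QSemigroup.elemTensor QSemigroup.toeplitzT QSemigroup.toeplitzT →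
          Δ' = Δ) ∧
      (∀ n m : ℕ, Δ (QSemigroup.toeplitzMonomial n m)
          = QSemigroup.elemTensor (QSemigroup.toeplitzMonomial n m)
              (QSemigroup.toeplitzMonomial n m)) ∧
      QSemigroup.IsCompactQuantumSemigroup QSemigroup.toeplitz Δ ∧
      QSemigroup.Cocommutative Δ ∧
      ∀ a : QSemigroup.toeplitz, ‖Δ a‖ = ‖a‖ := by
  open QSemigroup in
  obtain ⟨U, hU⟩ := exists_diagonal_unitary
  -- Raising `k` by one with `d` fixed raises both indices of `U (e_k ⊗ e_d)` by one.
  have hshift : conjAmpl U shift = opTensor shift shift := by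
    refine conjAmpl_eq_of_isTotal ((isTotal_single ℕ).vecTensor (isTotal_single ℤ)) U ?_
    intro p
    simp only [opTensor_vecTensor, hU, shift_single, one_apply_eq_self, Nat.add_right_comm]
  have hmem : ∀ a ∈ toeplitz, conjAmpl U a ∈ minTensor toeplitz toeplitz := fun a ha => by
    refine map_mem_of_mem_closure_adjoin (conjAmpl U) (isClosed_minTensor _ _)
      (s := {shift}) ?_ ha
    rintro _ rfl
    rw [hshift]
    exact (elemTensor toeplitzT toeplitzT).2
  let Δ : toeplitz →⋆ₐ[ℂ] minTensor toeplitz toeplitz := restrictHom (conjAmpl U) _ _ hmem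
  have hΔT : Δ toeplitzT = elemTensor toeplitzT toeplitzT := Subtype.ext hshift
  have hΔ : ∀ a : toeplitz, (Δ a : HilbertTensor EllTwo EllTwo →L[ℂ] HilbertTensor EllTwo EllTwo)
      = conjAmpl U a := fun a => rfl
  refine ⟨Δ, hΔT, fun Δ' h => toeplitz_hom_ext (h.trans hΔT.symm), fun n m => ?_,
    ⟨StarAlgebra.elemental.isClosed ℂ shift, ?_⟩, ?_, fun a => ?_⟩
  · rw [toeplitzMonomial, map_mul, map_pow, map_pow, map_star, hΔT, elemTensor_mul,
      elemTensor_pow, elemTensor_pow, star_elemTensor]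
  · exact coassociative_of_grouplike hΔT (fun _ _ => toeplitz_hom_ext) U hΔ
  · exact cocommutative_of_grouplike hΔT fun _ _ => toeplitz_hom_ext
  -- Injective *-homomorphisms of C*-algebras are isometric; here this is used on all bounded
  -- operators, not only on the Toeplitz algebra.
  · exact NonUnitalStarAlgHom.norm_map (conjAmpl U) (conjAmpl_injective U) (a : EllTwo →L[ℂ] EllTwo)
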